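/- Let $\alpha$ be a countable ordinal with $\alpha\ge 3$. For every limit ordinal $\delta\le\alpha$ fix a strictly increasing sequence $(\delta_k)_{k\in\mathbb N}$ cofinal in $\delta$. Let $T_\alpha\subset\mathbb N^{<\omega}$ be the tree, with rank function $\mathrm{rk}$, such that the root $\langle\rangle$ has rank $\alpha$; a node $\sigma$ of limit rank $\delta$ has the children $\sigma^\frown k$, $k\in\mathbb N$, of rank $\delta_k$; a node $\sigma$ of rank $\beta+1$ has the children $\sigma^\frown k$, $k\in\mathbb N$, all of rank $\beta$; and the nodes of rank $0$ are the leaves. Assume that the sequences are chosen so that no $\sigma\in T_\alpha$ of length at most $2$ is a leaf (for instance, every $\delta_k$ is the successor of a successor ordinal). Let $\mathscr L_\alpha$ be the set of leaves. For $x\in 2^{\mathscr L_\alpha}$ let $T^x\colon T_\alpha\to\{0,1\}$ be the unique labelling that extends $x$ and satisfies, for every $\sigma\in T_\alpha\setminus\mathscr L_\alpha$, $T^x(\sigma)=0$ if and only if $T^x(\sigma^\frown k)=1$ for some $k$. Let $\mathbb X_\alpha=2^{\mathscr L_\alpha}\times\mathscr P(\mathbb N)$, with the product topology ($\mathscr P(\mathbb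 N)$ is identified with Cantor space $2^{\mathbb N}$). Let $K_\alpha$ be the directed graph on $\mathbb X_\alpha$ with an edge from $(x,y)$ to $(x',y')$ exactly when $x'=x$, $T^x(\langle\rangle)=0$, and, for the least $n$ with $T^x(\langle n\rangle)=1$, $y\bigtriangleup y'=\{n\}$ and $n\notin y$. For $x\in 2^{\mathscr L_\alpha}$ let $n^x=\sup\{n\in\mathbb N : T^x(\langle m\rangle)=0\text{ for all }m<n\}\in\mathbb N\cup\{\infty\}$, and for $m<n^x$ let $k^x(m)$ be the least $k$ with $T^x(\langle m,k\rangle)=1$. Let $(M_k)_{k\in\mathbb N}$ be a dense sequence in Cantor space. Let $\mathbb W_\alpha$ be the set of all $(x,y)\in\mathbb X_\alpha$ such that for all $m<n^x$, $y{\restriction}(m+1)$ is an initial segment of $M_{k^x(m)}$, with the subspace topology, and let $L_\alpha$ be the restriction of $K_\alpha$ to $\mathbb W_\alpha$. Theorem. There is no countable $\boldsymbol\Sigma^0_\alpha$ colouring of $L_\alpha$; that is, there is no function $c\colon\mathbb W_\alpha\to\mathbb N$ such that $c^{-1}(\{n\})$ is a $\boldsymbol\Sigma^0_\alpha$ subset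 of $\mathbb W_\alpha$ for every $n$, and $c(a)\ne c(b)$ whenever there is an edge of $L_\alpha$ from $a$ to $b$. -/

import Mathlib

open scoped Ordinal

/-! ### The additive Borel classes -/

/-- `SigmaZero ξ A` : the set `A` is in the boldface class `Σ⁰_ξ` of the topological space `X`.
The class `Σ⁰_1` consists of the open sets, and for `ξ > 1` the class `Σ⁰_ξ` consists of the
countable unions of sets whose complements are in `Σ⁰_β` for some `1 ≤ β < ξ`.
(There is no class `Σ⁰_0`, so `1 ≤ β n` and `1 < ξ` are automatic in the second clause.) -/
inductive SigmaZero {X : Type*} [TopologicalSpace X] : Ordinal.{0} → Set X → Prop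
  | ofOpen {U : Set X} : IsOpen U → SigmaZero 1 U
  | iUnion {ξ : Ordinal.{0}} (β : ℕ → Ordinal.{0}) (A : ℕ → Set X) :
      (∀ n, β n < ξ) → (∀ n, SigmaZero (β n) (A n)ᶜ) → SigmaZero ξ (⋃ n, A n)

/-- A countable `Σ⁰_ξ` colouring of a directed graph on a topological space: a map to a countable
set of colours which separates the ends of every edge, and all of whose colour classes
are `Σ⁰_ξ`. -/
def HasCountableSigmaColouring {X : Type*} [TopologicalSpace X] (ξ : Ordinal.{0})
    (G : Digraph X) : Prop :=
  ∃ c : X → ℕ, (∀ a b, G.Adj a b → c a ≠ c b) ∧ ∀ n, SigmaZero ξ (c ⁻¹' {n})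

/-- The restriction of a directed graph to a set of vertices. -/
def Digraph.restrict {X : Type*} (G : Digraph X) (W : Set X) : Digraph W where
  Adj a b := G.Adj a b

/-! ### The tree -/

/-- A choice, for every limit ordinal `δ ≤ α`, of an increasing cofinal sequence in `δ`.
The values of `seq` at other ordinals are irrelevant. -/
structure LadderSystem (α : Ordinal.{0}) where
  seq : Ordinal.{0} → ℕ → Ordinal.{0}
  strictMono : ∀ δ ≤ α, Order.IsSuccLimit δ → StrictMono (seq δ)
  lt : ∀ δ ≤ α, Order.IsSuccLimit δ → ∀ k, seq δ k < δ
  cofinal : ∀ δ ≤ α, Order.IsSuccLimit δ → ∀ β < δ, ∃ k, β ≤ seq δ k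

namespace LadderSystem

variable {α : Ordinal.{0}} (F : LadderSystem α)

open Classical in
/-- The rank of the `k`-th child of a node of rank `β ≠ 0`: it is `β_k` if `β` is a limit, and
`γ` if `β = γ + 1`. -/
noncomputable def childRank (β : Ordinal.{0}) (k : ℕ) : Ordinal.{0} :=
  if Order.IsSuccLimit β then F.seq β k else Ordinal.pred β

/-- The rank of the node `σ`; the root has rank `α`. -/
noncomputable def rank (σ : List ℕ) : Ordinal.{0} := σ.foldl F.childRank α

/-- The tree `T_α`: it contains the root, and all the children `σ ++ [k]` of each of its nodes `σ`
of nonzero rank. -/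
inductive IsNode : List ℕ → Prop
  | root : IsNode []
  | child {σ : List ℕ} (k : ℕ) : IsNode σ → F.rank σ ≠ 0 → IsNode (σ ++ [k])

/-- The set of leaves of `T_α`. -/
def Leaf : Type := {σ : List ℕ // F.IsNode σ ∧ F.rank σ = 0}

theorem rank_append (σ : List ℕ) (k : ℕ) :
    F.rank (σ ++ [k]) = F.childRank (F.rank σ) k := by
  simp [rank, List.foldl_append]

theorem childRank_lt {β : Ordinal.{0}} (hβ : β ≤ α) (h0 : β ≠ 0) (k : ℕ) :
    F.childRank β k < β := by
  unfold childRank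
  split_ifs with h
  · exact F.lt β hβ h k
  · rw [Ordinal.pred_lt_iff_not_isSuccPrelimit]
    intro h'
    exact h ⟨by simpa using h0, h'⟩

theorem childRank_le {β : Ordinal.{0}} (hβ : β ≤ α) (k : ℕ) : F.childRank β k ≤ β := by
  by_cases h0 : β = 0
  · subst h0
    simp [childRank]
  · exact (F.childRank_lt hβ h0 k).le

theorem rank_le (σ : List ℕ) : F.rank σ ≤ α := by
  induction σ using List.reverseRecOn with
  | nil => exact le_rfl
  | append_singleton σ k ih =>
    rw [rank_append]
    exact (F.childRank_le ih k).trans ih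

theorem rank_child_lt {σ : List ℕ} (h : F.rank σ ≠ 0) (k : ℕ) :
    F.rank (σ ++ [k]) < F.rank σ := by
  rw [rank_append]
  exact F.childRank_lt (F.rank_le σ) h k

open Classical in
/-- The labelling `T^x` of the tree determined by a labelling `x` of its leaves, with `false` and
`true` for the labels `0` and `1`. At a leaf it agrees with `x`, and a node which is not a leaf
has label `1` exactly if all its children have label `0`. (The value at a sequence outside the
tree is irrelevant.) -/
noncomputable def label (x : F.Leaf → Bool) (σ : List ℕ) : Bool :=
  if h : F.rank σ = 0 then
    if h' : F.IsNode σ then x ⟨σ, h', h⟩ else false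
  else decide (∀ k : ℕ, label x (σ ++ [k]) = false)
termination_by F.rank σ
decreasing_by exact F.rank_child_lt h k

theorem label_leaf (x : F.Leaf → Bool) (σ : F.Leaf) : F.label x σ.1 = x σ := by
  rw [label, dif_pos σ.2.2, dif_pos σ.2.1]
  rfl

theorem label_eq_false_iff (x : F.Leaf → Bool) {σ : List ℕ} (h : F.rank σ ≠ 0) :
    F.label x σ = false ↔ ∃ k : ℕ, F.label x (σ ++ [k]) = true := by
  rw [label, dif_neg h]
  simp

/-! ### The graphs -/

/-- The space `𝕏_α = 2^Leaf × 2^ℕ`, with the product topology. A point `y` of the second factor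
stands for the set `{n | y n = true}`. -/
abbrev Point : Type := (F.Leaf → Bool) × (ℕ → Bool)

/-- The directed graph `K_α`: there is an edge from `(x, y)` to `(x', y')` if `x' = x`, the root
has label `0` in `T^x`, and for the least `n` with `T^x(⟨n⟩) = 1` we have `y ∆ y' = {n}`
and `n ∉ y`. -/
def graphK : Digraph F.Point where
  Adj p q := q.1 = p.1 ∧ F.label p.1 [] = false ∧
    ∃ n : ℕ, IsLeast {n | F.label p.1 [n] = true} n ∧
      symmDiff {i | p.2 i = true} {i | q.2 i = true} = {n} ∧ n ∉ {i | p.2 i = true}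

/-- The number `n^x ∈ ℕ ∪ {∞}`, the supremum of all `n` such that `T^x(⟨m⟩) = 0` for all
`m < n`. -/
noncomputable def nx (x : F.Leaf → Bool) : ℕ∞ :=
  ⨆ n ∈ {n : ℕ | ∀ m < n, F.label x [m] = false}, (n : ℕ∞)

/-- The number `k^x(m)`, the least `k` with `T^x(⟨m, k⟩) = 1`; it is used only for `m < n^x`. -/
noncomputable def kx (x : F.Leaf → Bool) (m : ℕ) : ℕ :=
  sInf {k : ℕ | F.label x [m, k] = true}

/-- The set `𝕎_α` of the points `(x, y)` such that, for all `m < n^x`, the string `y ↾ (m + 1)` is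
an initial segment of `M_k` for `k = k^x(m)`. -/
def setW (M : ℕ → ℕ → Bool) : Set F.Point :=
  {p | ∀ m : ℕ, (m : ℕ∞) < F.nx p.1 → ∀ i < m + 1, p.2 i = M (F.kx p.1 m) i}

/-- The directed graph `L_α`, the restriction of `K_α` to `𝕎_α`. -/
def graphL (M : ℕ → ℕ → Bool) : Digraph (F.setW M) := F.graphK.restrict (F.setW M)

end LadderSystem

/-!
In place of `2^Leaf` consider labellings of all finite sequences, without leaves, in which `⟨m⟩` has
label `0` exactly for `m ∈ S`. Those which, together with a point of Cantor space, satisfy the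
condition defining `𝕎_α` form a Polish space `C S`, which is mapped continuously to `𝕎_α` by
restricting labellings to the leaves. In `C univ` the root has label `1`, whereas a point of `C n`,
for `n = {0, …, n - 1}`, stays in `C n` when its Cantor space component is flipped at `n`, which
gives an edge of `L_α`.

Labels `1` alone describe the topology, since a label `0` is witnessed by a label `1` at a child.
Forget, in a finite set of labels `1`, what it says about nodes of rank above `γ < α`. By induction
on `γ`, if a `Σ⁰_γ` subset of `𝕎_α` is meagre in a neighbourhood given by such a set in `C S`, then
it is meagre in the larger neighbourhood given by what remains in `C S'`, whenever `S` and `S'`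
contain all `m` for which `⟨m⟩` has rank below `γ`: two points which agree on what remains can be
amalgamated as far as low ranks are concerned. For large `m` the first child of `⟨m⟩` with label `1`
is required to have large rank, so that the condition relating it to the Cantor space component does
not obstruct this.

If a colouring existed, then by the Baire category theorem some colour class would contain a set
`P` with `Σ⁰_γ` complement, `γ < α`, that is comeagre in an open subset of `C univ`. By the transfer
it is comeagre in a nonempty open subset of some `C n` that is invariant under the flip at `n`, so
it contains both ends of an edge.
-/

open Filter Set Topology

namespace SigmaZero

variable {X Y : Type*} [TopologicalSpace X] [TopologicalSpace Y] {ξ : Ordinal.{0}}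

theorem preimage {f : X → Y} (hf : Continuous f) {A : Set Y} (hA : SigmaZero ξ A) :
    SigmaZero ξ (f ⁻¹' A) := by
  induction hA with
  | ofOpen hU => exact .ofOpen (hU.preimage hf)
  | iUnion β A hβ _ ih =>
    rw [preimage_iUnion]
    exact .iUnion β _ hβ ih

theorem baireMeasurableSet {A : Set X} (hA : SigmaZero ξ A) : BaireMeasurableSet A := by
  induction hA with
  | ofOpen hU => exact hU.baireMeasurableSet
  | iUnion _ A _ _ ih => exact .iUnion fun n => (ih n).of_compl

theorem exists_eq_iUnion {A : Set X} (hA : SigmaZero ξ A) (hξ : ξ ≠ 1) :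
    ∃ (β : ℕ → Ordinal.{0}) (P : ℕ → Set X),
      (∀ n, β n < ξ) ∧ (∀ n, SigmaZero (β n) (P n)ᶜ) ∧ A = ⋃ n, P n := by
  cases hA with
  | ofOpen => exact absurd rfl hξ
  | iUnion β P hβ hP => exact ⟨β, P, hβ, hP, rfl⟩

end SigmaZero

section BaireCategory

variable {X Y : Type*} [TopologicalSpace X] [TopologicalSpace Y]

theorem exists_isOpen_isMeagre_diff {U D : Set X} (hU : IsOpen U) (hD : BaireMeasurableSet D)
    (h : ¬ IsMeagre (U ∩ D)) : ∃ V ⊆ U, IsOpen V ∧ V.Nonempty ∧ IsMeagre (V \ D) := by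
  obtain ⟨G, hG, hDG⟩ := hD.residualEq_isOpen
  refine ⟨U ∩ G, inter_subset_left, hU.inter hG, ?_, ?_⟩
  · refine nonempty_iff_ne_empty.2 fun hempty => h ?_
    filter_upwards [hDG.mem_iff] with x hx hxUD
    exact hempty.subset ⟨hxUD.1, hx.1 hxUD.2⟩
  · filter_upwards [hDG.mem_iff] with x hx hxVD
    exact hxVD.2 (hx.2 hxVD.1.2)

theorem exists_mem_inter_of_isMeagre_diff [BaireSpace X] {U D E : Set X} (hU : IsOpen U)
    (hne : U.Nonempty) (hD : IsMeagre (U \ D)) (hE : IsMeagre (U \ E)) : (U ∩ D ∩ E).Nonempty := by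
  by_contra hempty
  refine not_isMeagre_of_isOpen hU hne ((hD.union hE).mono fun x hx => ?_)
  by_contra hx'
  simp only [mem_union, Set.mem_sdiff, hx, true_and, not_or, not_not] at hx'
  exact hempty ⟨x, ⟨hx, hx'.1⟩, hx'.2⟩

theorem exists_comeagre_piece_of_sigmaZero_fibers [BaireSpace X] [Nonempty X] {f : X → Y}
    (hf : Continuous f) {ξ : Ordinal.{0}} (hξ : ξ ≠ 1) {c : Y → ℕ}
    (hc : ∀ n, SigmaZero ξ (c ⁻¹' {n})) :
    ∃ β < ξ, ∃ (n : ℕ) (P : Set Y), P ⊆ c ⁻¹' {n} ∧ SigmaZero β Pᶜ ∧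
      ∃ V : Set X, IsOpen V ∧ V.Nonempty ∧ IsMeagre (V \ f ⁻¹' P) := by
  choose β P hβ hP hcP using fun n => (hc n).exists_eq_iUnion hξ
  obtain ⟨n, j, hnj⟩ : ∃ n j, ¬ IsMeagre (f ⁻¹' P n j) := by
    by_contra! hmeagre
    refine not_isMeagre_of_isOpen isOpen_univ univ_nonempty
      ((isMeagre_iUnion fun n => isMeagre_iUnion (hmeagre n)).mono fun x _ => ?_)
    obtain ⟨j, hj⟩ := mem_iUnion.1 ((hcP (c (f x))).subset (rfl : c (f x) = c (f x)))
    exact mem_iUnion₂.2 ⟨_, j, hj⟩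
  have hmeas : BaireMeasurableSet (f ⁻¹' P n j) :=
    .of_compl ((hP n j).preimage hf).baireMeasurableSet
  obtain ⟨V, -, hV⟩ := exists_isOpen_isMeagre_diff isOpen_univ hmeas (by rwa [univ_inter])
  exact ⟨β n j, hβ n j, n, P n j, (subset_iUnion _ j).trans (hcP n).superset, hP n j, V, hV⟩

end BaireCategory

section ProductSpaces

theorem exists_finset_forall_eq_imp_mem {ι X Y : Type*} [TopologicalSpace X] [TopologicalSpace Y]
    {V : Set ((ι → X) × (ℕ → Y))} (hV : IsOpen V) {z : (ι → X) × (ℕ → Y)} (hz : z ∈ V) :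
    ∃ (I : Finset ι) (ℓ : ℕ), ∀ w : (ι → X) × (ℕ → Y), (∀ i ∈ I, w.1 i = z.1 i) →
      (∀ i < ℓ, w.2 i = z.2 i) → w ∈ V := by
  obtain ⟨U₁, U₂, hU₁, hU₂, hz₁, hz₂, hU⟩ := isOpen_prod_iff.1 hV z.1 z.2 hz
  obtain ⟨I₁, u₁, hu₁, hI₁⟩ := isOpen_pi_iff.1 hU₁ z.1 hz₁
  obtain ⟨I₂, u₂, hu₂, hI₂⟩ := isOpen_pi_iff.1 hU₂ z.2 hz₂
  refine ⟨I₁, I₂.sup (· + 1), fun w hw₁ hw₂ =>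
    hU ⟨hI₁ fun i hi => ?_, hI₂ fun i hi => ?_⟩⟩
  · rw [hw₁ i hi]
    exact (hu₁ i hi).2
  · rw [hw₂ i (Finset.le_sup (f := (· + 1)) hi)]
    exact (hu₂ i hi).2

theorem isOpen_setOf_forall_mem_eq {ι X : Type*} [TopologicalSpace X] [DiscreteTopology X]
    {I : Set ι} (hI : I.Finite) (a : ι → X) : IsOpen {x : ι → X | ∀ i ∈ I, x i = a i} :=
  isOpen_set_pi hI fun i _ => isOpen_discrete {a i}

theorem exists_ge_forall_le_eq_of_denseRange {M : ℕ → ℕ → Bool} (hM : DenseRange M) (y : ℕ → Bool)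
    (m b : ℕ) : ∃ k ≥ b, ∀ i ≤ m, y i = M k i := by
  -- Beyond `m`, diagonalise against `M 0, …, M (b - 1)`.
  let y' : ℕ → Bool := fun i => if i ≤ m then y i else !M (i - (m + 1)) i
  obtain ⟨k, hk⟩ := hM.exists_mem_open (isOpen_setOf_forall_mem_eq (finite_lt_nat (m + 1 + b)) y')
    ⟨y', fun _ _ => rfl⟩
  refine ⟨k, ?_, fun i hi => ?_⟩
  · by_contra! hkb
    have := hk (m + 1 + k) (by simpa using hkb)
    simp [y', show ¬ m + 1 + k ≤ m by omega] at this
  · simp [hk i (show i < m + 1 + b by omega), y', hi]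

end ProductSpaces

/-- A labelling of all finite sequences, with no leaves, in which a sequence has label `1` exactly
if all its children have label `0`. -/
def IsConsistent (T : List ℕ → Bool) : Prop :=
  ∀ σ, T σ = true ↔ ∀ k : ℕ, T (σ ++ [k]) = false

/-- The sequence `σ` itself if it has label `1`, and otherwise its first child with label `1`.
A label `1` at this sequence guarantees the label `T σ` at `σ`, so that labels `1` alone carry all
information about a consistent labelling. -/
noncomputable def positiveWitness (T : List ℕ → Bool) (σ : List ℕ) : List ℕ :=
  if T σ = true then σ else σ ++ [sInf {k : ℕ | T (σ ++ [k]) = true}]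

theorem positiveWitness_of_eq_true {T : List ℕ → Bool} {σ : List ℕ} (hσ : T σ = true) :
    positiveWitness T σ = σ := if_pos hσ

theorem exists_positiveWitness_eq_append {T : List ℕ → Bool} {σ : List ℕ} (hσ : T σ = false) :
    ∃ k, positiveWitness T σ = σ ++ [k] :=
  ⟨_, if_neg (Bool.not_eq_true _ ▸ hσ)⟩

namespace IsConsistent

variable {T T' : List ℕ → Bool} {σ : List ℕ}

theorem eq_false_iff (hT : IsConsistent T) : T σ = false ↔ ∃ k : ℕ, T (σ ++ [k]) = true := by
  rw [← not_iff_not, Bool.not_eq_false, hT σ]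
  simp

theorem child_eq_false (hT : IsConsistent T) (hσ : T σ = true) (k : ℕ) : T (σ ++ [k]) = false :=
  (hT σ).1 hσ k

theorem eq_false_of_child (hT : IsConsistent T) {k : ℕ} (hk : T (σ ++ [k]) = true) : T σ = false :=
  hT.eq_false_iff.2 ⟨k, hk⟩

theorem positiveWitness_eq_true (hT : IsConsistent T) (σ : List ℕ) :
    T (positiveWitness T σ) = true := by
  unfold positiveWitness
  split_ifs with hσ
  · exact hσ
  · exact Nat.sInf_mem (hT.eq_false_iff.1 (Bool.eq_false_of_not_eq_true hσ))

theorem eq_of_positiveWitness (hT' : IsConsistent T')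
    (h : T' (positiveWitness T σ) = true) : T' σ = T σ := by
  unfold positiveWitness at h
  split_ifs at h with hσ
  · rw [h, hσ]
  · rw [hT'.eq_false_of_child h, Bool.eq_false_of_not_eq_true hσ]

end IsConsistent

section GreedyLabelling

variable (P₁ P₀ : Set (List ℕ))

/-- No prescription prevents `σ` from having label `1`, when `P₁` and `P₀` are the sets of
sequences with prescribed labels `1` and `0`. -/
def IsVacant (σ : List ℕ) : Prop := σ ∉ P₀ ∧ ∀ k : ℕ, σ ++ [k] ∉ P₁

/-- The set of sequences which get label `1` when, starting from the root, the label `1` is given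
whenever neither the prescriptions `P₁` and `P₀` nor the label of the parent prevent it. -/
def greedyTrue (σ : List ℕ) : Prop :=
  σ.reverseRecOn (motive := fun _ => Prop) ([] ∈ P₁ ∨ IsVacant P₁ P₀ [])
    fun τ k ih => τ ++ [k] ∈ P₁ ∨ (¬ ih ∧ IsVacant P₁ P₀ (τ ++ [k]))

variable {P₁ P₀} {σ : List ℕ}

theorem greedyTrue_nil : greedyTrue P₁ P₀ [] ↔ [] ∈ P₁ ∨ IsVacant P₁ P₀ [] := by
  simp only [greedyTrue, List.reverseRecOn_nil]

theorem greedyTrue_append (k : ℕ) : greedyTrue P₁ P₀ (σ ++ [k]) ↔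
    σ ++ [k] ∈ P₁ ∨ (¬ greedyTrue P₁ P₀ σ ∧ IsVacant P₁ P₀ (σ ++ [k])) := by
  simp only [greedyTrue, List.reverseRecOn_concat]

theorem greedyTrue_of_mem (hσ : σ ∈ P₁) : greedyTrue P₁ P₀ σ := by
  cases σ using List.reverseRecOn with
  | nil => exact greedyTrue_nil.2 (Or.inl hσ)
  | append_singleton τ k => exact (greedyTrue_append k).2 (Or.inl hσ)

theorem greedyTrue.isVacant (h : greedyTrue P₁ P₀ σ) (hσ : σ ∉ P₁) : IsVacant P₁ P₀ σ := by
  cases σ using List.reverseRecOn with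
  | nil => exact (greedyTrue_nil.1 h).resolve_left hσ
  | append_singleton τ k => exact (((greedyTrue_append k).1 h).resolve_left hσ).2

theorem exists_isConsistent_extending (hdisj : Disjoint P₁ P₀)
    (hchild : ∀ σ ∈ P₁, ∀ k : ℕ, σ ++ [k] ∉ P₁)
    (hfree : ∀ σ ∉ P₁, ∃ k : ℕ, σ ++ [k] ∈ P₁ ∨ IsVacant P₁ P₀ (σ ++ [k])) :
    ∃ T : List ℕ → Bool, IsConsistent T ∧ (∀ σ ∈ P₁, T σ = true) ∧ ∀ σ ∈ P₀, T σ = false := by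
  classical
  refine ⟨fun σ => decide (greedyTrue P₁ P₀ σ), fun σ => ?_,
    fun σ hσ => decide_eq_true (greedyTrue_of_mem hσ), fun σ hσ => decide_eq_false fun h => ?_⟩
  · simp only [decide_eq_true_eq, decide_eq_false_iff_not]
    constructor
    · intro h k hk
      rcases (greedyTrue_append k).1 hk with hmem | ⟨hnot, -⟩
      · by_cases hσ : σ ∈ P₁
        · exact hchild σ hσ k hmem
        · exact (h.isVacant hσ).2 k hmem
      · exact hnot h
    · intro h
      by_contra hnot
      obtain ⟨k, hk⟩ := hfree σ (mt greedyTrue_of_mem hnot)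
      exact h k ((greedyTrue_append k).2 (hk.imp_right fun hvacant => ⟨hnot, hvacant⟩))
  · exact (h.isVacant fun hσ' => disjoint_left.1 hdisj hσ' hσ).1 hσ

end GreedyLabelling

section CoherentPoints

/-- The space of pairs of a labelling of all finite sequences and a point of Cantor space. -/
abbrev LabelledPoint : Type := (List ℕ → Bool) × (ℕ → Bool)

/-- The analogue, for labellings of all finite sequences, of the condition defining `setW`: the
labels are consistent, `⟨m⟩` has label `0` exactly for `m ∈ S`, and then the first child of `⟨m⟩`
with label `1` is some `⟨m, k⟩` such that the point of Cantor space agrees with `M k` up to `m`.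
The lower bound `J m` for `k` ensures that `⟨m, k⟩` has large rank. -/
structure IsCoherent (J : ℕ → ℕ) (M : ℕ → ℕ → Bool) (S : Set ℕ) (z : LabelledPoint) : Prop where
  isConsistent : IsConsistent z.1
  label_eq_true : ∀ m ∉ S, z.1 [m] = true
  exists_witness : ∀ m ∈ S, ∃ k ≥ J m, IsLeast {k | z.1 [m, k] = true} k ∧ ∀ i ≤ m, z.2 i = M k i

/-- The space of coherent labelled points. -/
abbrev CoherentPoint (J : ℕ → ℕ) (M : ℕ → ℕ → Bool) (S : Set ℕ) : Type :=
  {z : LabelledPoint // IsCoherent J M S z}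

theorem isLeast_eq_true_iff {p : ℕ → Bool} {k : ℕ} :
    IsLeast {k | p k = true} k ↔ p k = true ∧ ∀ j < k, p j = false := by
  refine and_congr_right fun _ => forall_congr' fun j => ?_
  rw [← not_imp_not, not_le, mem_ofPred_eq, Bool.not_eq_true]

theorem isClopen_label_eq (σ : List ℕ) (b : Bool) : IsClopen {z : LabelledPoint | z.1 σ = b} :=
  (isClopen_discrete {b}).preimage ((continuous_apply σ).comp continuous_fst)

theorem isClopen_real_eq (i : ℕ) (b : Bool) : IsClopen {z : LabelledPoint | z.2 i = b} :=
  (isClopen_discrete {b}).preimage ((continuous_apply i).comp continuous_snd)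

theorem isGδ_setOf_isConsistent : IsGδ {z : LabelledPoint | IsConsistent z.1} := by
  simp only [IsConsistent, ofPred_forall]
  refine .iInter fun σ => ?_
  have heq : {z : LabelledPoint | z.1 σ = true ↔ ∀ k : ℕ, z.1 (σ ++ [k]) = false} =
      ({z | z.1 σ = true} ∩ ⋂ k : ℕ, {z | z.1 (σ ++ [k]) = false}) ∪
        ({z | z.1 σ = false} ∩ ⋃ k : ℕ, {z | z.1 (σ ++ [k]) = true}) := by
    ext z
    simp [iff_iff_and_or_not_and_not]
  rw [heq]
  refine .union (IsClosed.isGδ ?_) (IsOpen.isGδ ?_)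
  · exact (isClopen_label_eq σ _).isClosed.inter
      (isClosed_iInter fun k => (isClopen_label_eq _ _).isClosed)
  · exact (isClopen_label_eq σ _).isOpen.inter
      (isOpen_iUnion fun k => (isClopen_label_eq _ _).isOpen)

theorem isGδ_setOf_isCoherent (J : ℕ → ℕ) (M : ℕ → ℕ → Bool) (S : Set ℕ) :
    IsGδ {z | IsCoherent J M S z} := by
  have heq : {z | IsCoherent J M S z} = {z | IsConsistent z.1} ∩
      ((⋂ m ∉ S, {z | z.1 [m] = true}) ∩ ⋂ m ∈ S, ⋃ k ≥ J m, {z | z.1 [m, k] = true} ∩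
        ((⋂ j < k, {z | z.1 [m, j] = false}) ∩ ⋂ i ≤ m, {z | z.2 i = M k i})) := by
    ext z
    simp only [mem_ofPred_eq, mem_inter_iff, mem_iInter, mem_iUnion, exists_prop]
    exact ⟨fun h => ⟨h.1, h.2, by simpa only [isLeast_eq_true_iff, and_assoc] using h.3⟩,
      fun h => ⟨h.1, h.2.1, by simpa only [isLeast_eq_true_iff, and_assoc] using h.2.2⟩⟩
  rw [heq]
  refine isGδ_setOf_isConsistent.inter (.inter (IsClosed.isGδ ?_) ?_)
  · exact isClosed_biInter fun m _ => (isClopen_label_eq _ _).isClosed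
  · refine .iInter fun m => .iInter fun _ => IsOpen.isGδ ?_
    refine isOpen_biUnion fun k _ => (isClopen_label_eq _ _).isOpen.inter (.inter ?_ ?_)
    · exact (finite_lt_nat k).isOpen_biInter fun j _ => (isClopen_label_eq _ _).isOpen
    · exact (finite_le_nat m).isOpen_biInter fun i _ => (isClopen_real_eq _ _).isOpen

namespace CoherentPoint

variable {J : ℕ → ℕ} {M : ℕ → ℕ → Bool} {S : Set ℕ}

instance : BaireSpace (CoherentPoint J M S) :=
  (isGδ_setOf_isCoherent J M S).baireSpace_of_t2Space_locallyCompactSpace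

/-- The labelling component of a coherent point. -/
abbrev labels (z : CoherentPoint J M S) : List ℕ → Bool := z.1.1

/-- The Cantor space component of a coherent point. -/
abbrev real (z : CoherentPoint J M S) : ℕ → Bool := z.1.2

theorem isConsistent (z : CoherentPoint J M S) : IsConsistent z.labels := z.2.isConsistent

theorem label_singleton_eq_false_iff (z : CoherentPoint J M S) (m : ℕ) :
    z.labels [m] = false ↔ m ∈ S := by
  refine ⟨fun h => ?_, fun hm => ?_⟩
  · by_contra hm
    exact Bool.false_ne_true (h.symm.trans (z.2.label_eq_true m hm))
  · obtain ⟨k, -, hk, -⟩ := z.2.exists_witness m hm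
    exact z.isConsistent.eq_false_of_child (σ := [m]) hk.1

theorem label_eq_label_of_length_lt_two (z w : CoherentPoint J M S) {σ : List ℕ}
    (hσ : σ.length < 2) : z.labels σ = w.labels σ := by
  have hsingleton (m : ℕ) : z.labels [m] = w.labels [m] := by
    rw [Bool.eq_iff_iff, ← not_iff_not, Bool.not_eq_true, Bool.not_eq_true,
      z.label_singleton_eq_false_iff, w.label_singleton_eq_false_iff]
  match σ with
  | [] =>
    rw [Bool.eq_iff_iff, z.isConsistent, w.isConsistent]
    exact forall_congr' fun m => by rw [List.nil_append, hsingleton m]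
  | [m] => exact hsingleton m

theorem mem_of_label_pair_eq_true (z : CoherentPoint J M S) {m j : ℕ}
    (h : z.labels [m, j] = true) : m ∈ S :=
  (z.label_singleton_eq_false_iff m).1 (z.isConsistent.eq_false_of_child (σ := [m]) h)

theorem le_of_label_pair_eq_true (z : CoherentPoint J M S) {m j : ℕ}
    (h : z.labels [m, j] = true) : J m ≤ j := by
  obtain ⟨k, hJk, hk, -⟩ := z.2.exists_witness m (z.mem_of_label_pair_eq_true h)
  exact hJk.trans (hk.2 h)

theorem isClopen_setOf_label_eq (σ : List ℕ) (b : Bool) :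
    IsClopen {z : CoherentPoint J M S | z.labels σ = b} :=
  (isClopen_label_eq σ b).preimage continuous_subtype_val

theorem isClopen_setOf_real_eq (i : ℕ) (b : Bool) :
    IsClopen {z : CoherentPoint J M S | z.real i = b} :=
  (isClopen_real_eq i b).preimage continuous_subtype_val

end CoherentPoint

end CoherentPoints

section Realisation

variable {J : ℕ → ℕ} {M : ℕ → ℕ → Bool} {S : Set ℕ} {κ : ℕ → ℕ} {Q : Set (List ℕ)}

/-- The sequences of length at most two that must get label `1` in a coherent point for `S` such
that `⟨m, κ m⟩` is the first child of `⟨m⟩` with label `1`, for all `m ∈ S`. -/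
def shortTrue (S : Set ℕ) (κ : ℕ → ℕ) : Set (List ℕ) :=
  {σ | σ = [] ∧ S = univ ∨ (∃ m ∉ S, σ = [m]) ∨ ∃ m ∈ S, σ = [m, κ m]}

/-- The sequences of length two that must get label `0` in a coherent point for `S` such that
`⟨m, κ m⟩` is the first child of `⟨m⟩` with label `1`, for all `m ∈ S`. -/
def shortFalse (S : Set ℕ) (κ : ℕ → ℕ) : Set (List ℕ) :=
  {σ | ∃ m ∈ S, ∃ j < κ m, σ = [m, j]}

theorem mem_union_shortTrue_iff_of_two_lt_length {σ : List ℕ} (hσ : 2 < σ.length) :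
    σ ∈ Q ∪ shortTrue S κ ↔ σ ∈ Q := by
  refine or_iff_left ?_
  rintro (⟨rfl, -⟩ | ⟨m, -, rfl⟩ | ⟨m, -, rfl⟩) <;> simp at hσ

theorem disjoint_union_shortTrue_shortFalse (hκle : ∀ m ∈ S, ∀ j < κ m, [m, j] ∉ Q) :
    Disjoint (Q ∪ shortTrue S κ) (shortFalse S κ) := by
  refine disjoint_right.2 ?_
  rintro _ ⟨m, hm, j, hj, rfl⟩ (hmem | ⟨hmem, -⟩ | ⟨m', -, hmem⟩ | ⟨m', -, hmem⟩)
  · exact hκle m hm j hj hmem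
  · simp at hmem
  · simp at hmem
  · obtain ⟨rfl, rfl⟩ : m = m' ∧ j = κ m' := by simpa using hmem
    exact hj.false

theorem append_notMem_union_shortTrue (hlen : ∀ σ ∈ Q, 2 ≤ σ.length)
    (hchild : ∀ σ ∈ Q, ∀ k : ℕ, σ ++ [k] ∉ Q) (hpair : ∀ m j : ℕ, [m, j] ∈ Q → m ∈ S)
    (hκQ : ∀ m ∈ S, ∀ j : ℕ, [m, κ m, j] ∉ Q) :
    ∀ σ ∈ Q ∪ shortTrue S κ, ∀ k : ℕ, σ ++ [k] ∉ Q ∪ shortTrue S κ := by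
  rintro σ (hσ | ⟨rfl, rfl⟩ | ⟨m, hm, rfl⟩ | ⟨m, hm, rfl⟩) k
  · rw [mem_union_shortTrue_iff_of_two_lt_length (by simpa using hlen σ hσ)]
    exact hchild σ hσ k
  · rintro (hk | ⟨hk, -⟩ | ⟨m, hm, -⟩ | ⟨m, -, hk⟩)
    · simpa using hlen _ hk
    · simp at hk
    · exact hm (mem_univ m)
    · simp at hk
  · rintro (hk | ⟨hk, -⟩ | ⟨m', -, hk⟩ | ⟨m', hm', hk⟩)
    · exact hm (hpair m k hk)
    · simp at hk
    · simp at hk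
    · exact hm (List.head_eq_of_cons_eq hk ▸ hm')
  · rw [mem_union_shortTrue_iff_of_two_lt_length (by simp)]
    exact hκQ m hm k

theorem finite_setOf_append_cons_mem (hQ : Q.Finite) (σ : List ℕ) :
    {k : ℕ | ∃ τ, σ ++ k :: τ ∈ Q}.Finite := by
  refine (hQ.image fun τ => τ.getD σ.length 0).subset ?_
  rintro k ⟨τ, hτ⟩
  exact ⟨_, hτ, by simp⟩

theorem exists_append_mem_or_isVacant (hQ : Q.Finite) :
    ∀ σ ∉ Q ∪ shortTrue S κ, ∃ k : ℕ, σ ++ [k] ∈ Q ∪ shortTrue S κ ∨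
      IsVacant (Q ∪ shortTrue S κ) (shortFalse S κ) (σ ++ [k]) := by
  intro σ hσ
  match σ with
  | [] =>
    obtain ⟨m, hm⟩ := (ne_univ_iff_exists_notMem S).1 fun hS => hσ (.inr (.inl ⟨rfl, hS⟩))
    exact ⟨m, .inl (.inr (.inr (.inl ⟨m, hm, rfl⟩)))⟩
  | [m] =>
    have hm : m ∈ S := by_contra fun hm => hσ (.inr (.inr (.inl ⟨m, hm, rfl⟩)))
    exact ⟨κ m, .inl (.inr (.inr (.inr ⟨m, hm, rfl⟩)))⟩
  | m :: j :: τ =>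
    obtain ⟨k, hk⟩ := (finite_setOf_append_cons_mem hQ (m :: j :: τ)).exists_notMem
    refine ⟨k, .inr ⟨?_, fun i => ?_⟩⟩
    · rintro ⟨m', -, j', -, heq⟩
      simp at heq
    · rw [mem_union_shortTrue_iff_of_two_lt_length (by simp)]
      exact fun hi => hk ⟨[i], by simpa using hi⟩

theorem exists_coherentPoint_of_witnesses (hQ : Q.Finite) (hlen : ∀ σ ∈ Q, 2 ≤ σ.length)
    (hchild : ∀ σ ∈ Q, ∀ k : ℕ, σ ++ [k] ∉ Q) (hpair : ∀ m j : ℕ, [m, j] ∈ Q → m ∈ S)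
    {y : ℕ → Bool} (hwitness : ∀ m ∈ S, ∃ k ≥ J m, (∀ i ≤ m, y i = M k i) ∧
      (∀ j < k, [m, j] ∉ Q) ∧ ∀ j : ℕ, [m, k, j] ∉ Q) :
    ∃ z : CoherentPoint J M S, z.real = y ∧ ∀ σ ∈ Q, z.labels σ = true := by
  choose! κ hκJ hκM hκle hκQ using hwitness
  obtain ⟨T, hT, hT₁, hT₀⟩ := exists_isConsistent_extending
    (disjoint_union_shortTrue_shortFalse hκle)
    (append_notMem_union_shortTrue hlen hchild hpair hκQ) (exists_append_mem_or_isVacant hQ)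
  have hleast : ∀ m ∈ S, IsLeast {k | T [m, k] = true} (κ m) := fun m hm =>
    isLeast_eq_true_iff.2 ⟨hT₁ _ (.inr (.inr (.inr ⟨m, hm, rfl⟩))),
      fun j hj => hT₀ _ ⟨m, hm, j, hj, rfl⟩⟩
  refine ⟨⟨(T, y), hT, fun m hm => hT₁ _ (.inr (.inr (.inl ⟨m, hm, rfl⟩))), fun m hm =>
    ⟨κ m, hκJ m hm, hleast m hm, hκM m hm⟩⟩, rfl, fun σ hσ => hT₁ σ (.inl hσ)⟩

theorem exists_fresh_witness (hM : DenseRange M) (hQ : Q.Finite) (y : ℕ → Bool) (m b : ℕ) :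
    ∃ k ≥ b, (∀ i ≤ m, y i = M k i) ∧ ∀ j : ℕ, [m, k, j] ∉ Q := by
  obtain ⟨K, hK⟩ := (finite_setOf_append_cons_mem hQ [m]).bddAbove
  obtain ⟨k, hk, hkM⟩ := exists_ge_forall_le_eq_of_denseRange hM y m (max b (K + 1))
  exact ⟨k, (le_max_left _ _).trans hk, hkM, fun j hj =>
    ((Nat.lt_succ_self K).trans_le ((le_max_right _ _).trans hk)).not_ge (hK ⟨[j], hj⟩)⟩

end Realisation

section Windows

variable {J : ℕ → ℕ} {M : ℕ → ℕ → Bool} {S S₁ : Set ℕ} {A : Finset (List ℕ)} {ℓ : ℕ}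

/-- The basic open set of all coherent points with label `1` at the sequences in `A` that agree
with `y` below `ℓ`. -/
def basicNhd (A : Finset (List ℕ)) (ℓ : ℕ) (y : ℕ → Bool) : Set (CoherentPoint J M S) :=
  {w | (∀ σ ∈ A, w.labels σ = true) ∧ ∀ i < ℓ, w.real i = y i}

theorem isOpen_basicNhd (A : Finset (List ℕ)) (ℓ : ℕ) (y : ℕ → Bool) :
    IsOpen (basicNhd A ℓ y : Set (CoherentPoint J M S)) := by
  simp only [basicNhd, ofPred_and, ofPred_forall]
  exact (isOpen_biInter_finset fun σ _ => (CoherentPoint.isClopen_setOf_label_eq σ _).isOpen).inter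
    ((finite_lt_nat ℓ).isOpen_biInter fun i _ => (CoherentPoint.isClopen_setOf_real_eq i _).isOpen)

/-- A finite piece of positive information about the coherent point `z` that decides, for every
`m < ℓ`, the label of `⟨m⟩` and the first child of `⟨m⟩` with label `1`. -/
structure IsWindow (A : Finset (List ℕ)) (ℓ : ℕ) (z : CoherentPoint J M S) : Prop where
  label_eq_true : ∀ σ ∈ A, z.labels σ = true
  singleton_mem : ∀ m < ℓ, m ∉ S → [m] ∈ A
  lt_of_pair_mem : ∀ m j : ℕ, [m, j] ∈ A → m < ℓ
  witness_mem : ∀ m < ℓ, ∀ k, IsLeast {k | z.labels [m, k] = true} k →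
    [m, k] ∈ A ∧ ∀ j < k, ∃ i, [m, j, i] ∈ A

theorem isWindow_image_positiveWitness {z : CoherentPoint J M S} {B : Finset (List ℕ)}
    (hlt : ∀ m τ, m :: τ ∈ B → m < ℓ) (hsingleton : ∀ m < ℓ, [m] ∈ B)
    (hpair : ∀ m < ℓ, ∀ j ≤ sInf {k | z.labels [m, k] = true}, [m, j] ∈ B) :
    IsWindow (B.image (positiveWitness z.labels)) ℓ z where
  label_eq_true := Finset.forall_mem_image.2 fun σ _ => z.isConsistent.positiveWitness_eq_true σ
  singleton_mem m hm hmS := Finset.mem_image.2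
    ⟨[m], hsingleton m hm, positiveWitness_of_eq_true (z.2.label_eq_true m hmS)⟩
  lt_of_pair_mem m j hmj := by
    obtain ⟨τ, hτ, heq⟩ := Finset.mem_image.1 hmj
    cases τ with
    | nil =>
      unfold positiveWitness at heq
      split_ifs at heq
      simp at heq
    | cons m' τ =>
      have hhead : m' = m := by
        unfold positiveWitness at heq
        split_ifs at heq <;> exact List.head_eq_of_cons_eq heq
      exact hhead ▸ hlt m' τ hτ
  witness_mem m hm k hk := by
    have hpair' : ∀ j ≤ k, [m, j] ∈ B := hk.csInf_eq ▸ hpair m hm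
    refine ⟨Finset.mem_image.2 ⟨[m, k], hpair' k le_rfl, positiveWitness_of_eq_true hk.1⟩,
      fun j hj => ?_⟩
    obtain ⟨i, hi⟩ := exists_positiveWitness_eq_append ((isLeast_eq_true_iff.1 hk).2 j hj)
    exact ⟨i, Finset.mem_image.2 ⟨[m, j], hpair' j hj.le, hi⟩⟩

theorem exists_isWindow_basicNhd_subset {z : CoherentPoint J M S} {V : Set (CoherentPoint J M S)}
    (hV : IsOpen V) (hz : z ∈ V) (b : ℕ) :
    ∃ (A : Finset (List ℕ)) (ℓ : ℕ), b ≤ ℓ ∧ IsWindow A ℓ z ∧ basicNhd A ℓ z.real ⊆ V := by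
  obtain ⟨V', hV', rfl⟩ := isOpen_induced_iff.1 hV
  obtain ⟨I, a, hI⟩ := exists_finset_forall_eq_imp_mem hV' hz
  obtain ⟨ℓ, hbℓ, haℓ, hIℓ⟩ : ∃ ℓ, b ≤ ℓ ∧ a ≤ ℓ ∧ ∀ m τ, m :: τ ∈ I → m < ℓ :=
    ⟨b + a + I.sup fun σ => σ.headI + 1, by omega, by omega, fun m τ hm =>
      (Finset.le_sup (f := fun σ : List ℕ => σ.headI + 1) hm).trans (Nat.le_add_left _ _)⟩
  let B : Finset (List ℕ) := I ∪ (Finset.range ℓ).biUnion fun m =>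
    insert [m] ((Finset.range (sInf {k | z.labels [m, k] = true} + 1)).image fun j => [m, j])
  have hBℓ : ∀ m τ, m :: τ ∈ B → m < ℓ := by
    intro m τ hm
    rcases Finset.mem_union.1 hm with hm | hm
    · exact hIℓ m τ hm
    · obtain ⟨m', hm', hm⟩ := Finset.mem_biUnion.1 hm
      have hhead : m = m' := by
        simp only [Finset.mem_insert, Finset.mem_image, List.cons.injEq] at hm
        rcases hm with ⟨h, -⟩ | ⟨_, -, h, -⟩
        exacts [h, h.symm]
      exact hhead ▸ Finset.mem_range.1 hm'
  refine ⟨B.image (positiveWitness z.labels), ℓ, hbℓ, isWindow_image_positiveWitness hBℓ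
    (fun m hm => ?_) (fun m hm j hj => ?_), fun w hw => hI w.1 (fun σ hσ => ?_) fun i hi =>
      hw.2 i (hi.trans_le haℓ)⟩
  · simp [B, hm]
  · simp [B, hm, hj]
  · exact w.isConsistent.eq_of_positiveWitness
      (hw.1 _ (Finset.mem_image_of_mem _ (Finset.mem_union_left _ hσ)))

theorem IsWindow.append_notMem {z : CoherentPoint J M S} (hz : IsWindow A ℓ z) {σ : List ℕ}
    (hσ : σ ∈ A) (k : ℕ) : σ ++ [k] ∉ A := fun hk =>
  Bool.false_ne_true ((z.isConsistent.child_eq_false (hz.label_eq_true σ hσ) k).symm.trans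
    (hz.label_eq_true _ hk))

theorem IsWindow.mem_of_pair_mem {z : CoherentPoint J M S} (hz : IsWindow A ℓ z) {m j : ℕ}
    (h : [m, j] ∈ A) : m ∈ S :=
  z.mem_of_label_pair_eq_true (hz.label_eq_true _ h)

theorem IsWindow.exists_extending {z : CoherentPoint J M S} (hz : IsWindow A ℓ z)
    (hM : DenseRange M) (hS₁ : ∀ m < ℓ, m ∈ S₁ → m ∈ S) {Q : Set (List ℕ)} (hQ : Q.Finite)
    (hlen : ∀ σ ∈ Q, 2 ≤ σ.length) (hchild : ∀ σ ∈ Q, ∀ k : ℕ, σ ++ [k] ∉ Q)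
    (hA : ∀ σ ∈ A, 2 ≤ σ.length → σ ∈ Q) (hpair : ∀ m j : ℕ, [m, j] ∈ Q → m ∈ S₁ ∧ m < ℓ)
    {y : ℕ → Bool} (hy : ∀ i < ℓ, y i = z.real i) :
    ∃ v : CoherentPoint J M S₁, v.real = y ∧ ∀ σ ∈ Q, v.labels σ = true := by
  refine exists_coherentPoint_of_witnesses hQ hlen hchild (fun m j h => (hpair m j h).1)
    fun m hm => ?_
  rcases lt_or_ge m ℓ with hmℓ | hmℓ
  · obtain ⟨k, hkJ, hk, hkM⟩ := z.2.exists_witness m (hS₁ m hmℓ hm)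
    obtain ⟨hkA, hltA⟩ := hz.witness_mem m hmℓ k hk
    refine ⟨k, hkJ, fun i hi => (hy i (hi.trans_lt hmℓ)).trans (hkM i hi), fun j hj hjQ => ?_,
      fun j => hchild _ (hA _ hkA le_rfl) j⟩
    obtain ⟨i, hi⟩ := hltA j hj
    exact hchild _ hjQ i (hA _ hi (by simp))
  · obtain ⟨k, hkJ, hkM, hkQ⟩ := exists_fresh_witness hM hQ y m (J m)
    exact ⟨k, hkJ, hkM, fun j _ hj => (hpair m j hj).2.not_ge hmℓ, hkQ⟩

end Windows

namespace LadderSystem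

variable {α : Ordinal.{0}} (F : LadderSystem α)

section Ranks

variable {γ : Ordinal.{0}} {σ : List ℕ}

theorem eventually_le_childRank {β : Ordinal.{0}} (hβ : β ≤ α) (hγ : γ < β) :
    ∀ᶠ k in atTop, γ ≤ F.childRank β k := by
  by_cases hlim : Order.IsSuccLimit β
  · obtain ⟨K, hK⟩ := F.cofinal β hβ hlim γ hγ
    filter_upwards [eventually_ge_atTop K] with k hk
    rw [childRank, if_pos hlim]
    exact hK.trans ((F.strictMono β hβ hlim).monotone hk)
  · refine .of_forall fun k => ?_
    rw [childRank, if_neg hlim]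
    have hpre : ¬ Order.IsSuccPrelimit β := fun hpre =>
      hlim ⟨by simpa using (zero_le.trans_lt hγ).ne', hpre⟩
    obtain ⟨δ, rfl⟩ := Order.not_isSuccPrelimit_iff_mem_range_succ.1 hpre
    simpa using Order.lt_succ_iff.1 hγ

theorem eventually_le_rank_append (hγ : γ < F.rank σ) :
    ∀ᶠ k in atTop, γ ≤ F.rank (σ ++ [k]) := by
  simpa only [rank_append] using F.eventually_le_childRank (F.rank_le σ) hγ

theorem finite_setOf_rank_append_lt (hγ : γ < F.rank σ) :
    {k : ℕ | F.rank (σ ++ [k]) < γ}.Finite := by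
  have h := F.eventually_le_rank_append hγ
  rw [← Nat.cofinite_eq_atTop, eventually_cofinite] at h
  simpa only [not_le] using h

theorem rank_append_le (σ : List ℕ) (k : ℕ) : F.rank (σ ++ [k]) ≤ F.rank σ := by
  rw [rank_append]
  exact F.childRank_le (F.rank_le σ) k

theorem rank_positiveWitness_le (T : List ℕ → Bool) (σ : List ℕ) :
    F.rank (positiveWitness T σ) ≤ F.rank σ := by
  unfold positiveWitness
  split_ifs
  · exact le_rfl
  · exact F.rank_append_le σ _

/-- The nodes `⟨m, j⟩` with `J m ≤ j` have eventually large ranks as `m` tends to infinity,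
uniformly in `j`. -/
def IsTailBound (J : ℕ → ℕ) : Prop :=
  ∀ γ : Ordinal.{0}, Order.succ γ < α → ∀ᶠ m in atTop, ∀ j ≥ J m, γ ≤ F.rank [m, j]

theorem exists_isTailBound_of_isSuccLimit (hα : Order.IsSuccLimit α) : ∃ J, F.IsTailBound J := by
  have hrank (m : ℕ) : F.rank [m] = F.seq α m := by simp [rank, childRank, hα]
  have hmono := F.strictMono α le_rfl hα
  have hchild (m : ℕ) : ∃ K, ∀ j ≥ K, F.seq α m ≤ F.rank [m + 1, j] :=
    eventually_atTop.1 (F.eventually_le_rank_append (σ := [m + 1])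
      (by rw [hrank]; exact hmono m.lt_succ_self))
  choose K hK using hchild
  refine ⟨fun m => K (m - 1), fun γ hγ => ?_⟩
  obtain ⟨N, hN⟩ := F.cofinal α le_rfl hα γ ((Order.le_succ γ).trans_lt hγ)
  filter_upwards [eventually_ge_atTop (N + 1)] with m hm j hj
  obtain ⟨m, rfl⟩ : ∃ m', m = m' + 1 := ⟨m - 1, by omega⟩
  exact (hN.trans (hmono.monotone (by omega))).trans (hK m j hj)

theorem exists_isTailBound : ∃ J, F.IsTailBound J := by
  by_cases hα : Order.IsSuccLimit α
  · exact F.exists_isTailBound_of_isSuccLimit hα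
  · have hrank (m : ℕ) : F.rank [m] = F.rank [0] := by simp [rank, childRank, hα]
    refine ⟨id, fun γ hγ => ?_⟩
    have hγ₀ : γ < F.rank [0] := by
      obtain ⟨K, hK⟩ := (F.eventually_le_childRank le_rfl hγ).exists
      exact Order.succ_le_iff.1 (hK.trans_eq (hrank K))
    obtain ⟨N, hN⟩ := eventually_atTop.1 (F.eventually_le_childRank (F.rank_le [0]) hγ₀)
    filter_upwards [eventually_ge_atTop N] with m hm j hj
    have := hN j (hm.trans hj)
    rwa [← hrank m] at this

end Ranks

section LowerNhd

variable {J : ℕ → ℕ} {M : ℕ → ℕ → Bool} {S S' : Set ℕ} {γ γ' : Ordinal.{0}}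
  {A A' : Finset (List ℕ)} {ℓ ℓ' : ℕ} {y : ℕ → Bool}

/-- The open set obtained from `basicNhd A ℓ y` by keeping only the information about nodes of
rank at most `γ`: a node of higher rank with label `1` is only known through the labels `0` of
its children of rank less than `γ`. -/
def lowerNhd (γ : Ordinal.{0}) (A : Finset (List ℕ)) (ℓ : ℕ) (y : ℕ → Bool) :
    Set (CoherentPoint J M S) :=
  {w | (∀ σ ∈ A, F.rank σ ≤ γ → w.labels σ = true) ∧
    (∀ σ ∈ A, γ < F.rank σ → ∀ k, F.rank (σ ++ [k]) < γ → w.labels (σ ++ [k]) = false) ∧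
    ∀ i < ℓ, w.real i = y i}

theorem isOpen_lowerNhd : IsOpen (F.lowerNhd γ A ℓ y : Set (CoherentPoint J M S)) := by
  simp only [lowerNhd, ofPred_and, ofPred_forall]
  refine .inter ?_ (.inter ?_ ?_)
  · exact isOpen_biInter_finset fun σ _ =>
      isOpen_iInter_of_finite fun _ => (CoherentPoint.isClopen_setOf_label_eq σ _).isOpen
  · exact isOpen_biInter_finset fun σ _ => isOpen_iInter_of_finite fun hσ =>
      (F.finite_setOf_rank_append_lt hσ).isOpen_biInter fun k _ =>
        (CoherentPoint.isClopen_setOf_label_eq _ _).isOpen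
  · exact (finite_lt_nat ℓ).isOpen_biInter fun i _ =>
      (CoherentPoint.isClopen_setOf_real_eq i _).isOpen

variable {F}

theorem label_append_eq_false_of_mem_lowerNhd {w : CoherentPoint J M S}
    (hw : w ∈ F.lowerNhd γ A ℓ y) {σ : List ℕ} (hσ : σ ∈ A) {k : ℕ}
    (hk : F.rank (σ ++ [k]) < γ) : w.labels (σ ++ [k]) = false := by
  rcases le_or_gt (F.rank σ) γ with hle | hlt
  · exact w.isConsistent.child_eq_false (hw.1 σ hσ hle) k
  · exact hw.2.1 σ hσ hlt k hk

theorem exists_mem_lowerNhd (hM : DenseRange M) (hγ : γ < α)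
    (hS : ∀ m, F.rank [m] < γ → m ∈ S ∩ Iio ℓ) {z : CoherentPoint J M S} (hz : IsWindow A ℓ z) :
    ∃ w : CoherentPoint J M (S ∩ Iio ℓ), w ∈ F.lowerNhd γ A ℓ z.real := by
  obtain ⟨w, hwreal, hw⟩ := hz.exists_extending hM (S₁ := S ∩ Iio ℓ) (fun m _ hm => hm.1)
    (Q := {σ ∈ A | 2 ≤ σ.length}) (A.finite_toSet.subset fun σ hσ => hσ.1) (fun σ hσ => hσ.2)
    (fun σ hσ k hk => hz.append_notMem hσ.1 k hk.1) (fun σ hσ hlen => ⟨hσ, hlen⟩)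
    (fun m j hmj => have hmℓ := hz.lt_of_pair_mem m j hmj.1
      ⟨⟨hz.mem_of_pair_mem hmj.1, hmℓ⟩, hmℓ⟩)
    (fun i _ => rfl)
  have hwA : ∀ σ ∈ A, σ ≠ [] → w.labels σ = true := by
    intro σ hσ hne
    match σ with
    | [m] =>
      refine w.2.label_eq_true m fun hm => ?_
      simpa [hz.label_eq_true _ hσ] using (z.label_singleton_eq_false_iff m).2 hm.1
    | m :: j :: τ => exact hw _ ⟨hσ, by simp⟩
  refine ⟨w, fun σ hσ hle => hwA σ hσ ?_, fun σ hσ hlt k hk => ?_, fun i _ => congrFun hwreal i⟩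
  · rintro rfl
    exact hγ.not_ge hle
  · by_cases hne : σ = []
    · subst hne
      exact (w.label_singleton_eq_false_iff k).2 (hS k hk)
    · exact w.isConsistent.child_eq_false (hwA σ hσ hne) k

theorem two_le_length_of_rank_lt (hγ : γ < α) (hS : ∀ m, F.rank [m] < γ → m ∈ S)
    {w : CoherentPoint J M S} {σ : List ℕ} (hσ : w.labels σ = true) (hlt : F.rank σ < γ) :
    2 ≤ σ.length := by
  match σ with
  | [] => exact absurd hlt hγ.not_gt
  | [m] => simpa [hσ] using (w.label_singleton_eq_false_iff m).2 (hS m hlt)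
  | _ :: _ :: _ => simp

theorem mem_and_lt_of_label_pair_eq_true (hJ : ∀ m ∈ S', ℓ ≤ m → ∀ j ≥ J m, γ ≤ F.rank [m, j])
    {z : CoherentPoint J M S} (hz : IsWindow A ℓ z) {w : CoherentPoint J M S'}
    (hw : w ∈ F.lowerNhd γ A ℓ y) {m j : ℕ} (hmj : w.labels [m, j] = true)
    (hlt : F.rank [m, j] < γ) : m ∈ S ∧ m < ℓ := by
  have hmℓ : m < ℓ := by
    by_contra! hℓm
    exact (hJ m (w.mem_of_label_pair_eq_true hmj) hℓm j
      (w.le_of_label_pair_eq_true hmj)).not_gt hlt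
  refine ⟨by_contra fun hm => ?_, hmℓ⟩
  simpa [hmj] using label_append_eq_false_of_mem_lowerNhd hw (hz.singleton_mem m hmℓ hm) hlt

theorem exists_amalgam (hM : DenseRange M) (hγ : γ < α) (hS' : ∀ m, F.rank [m] < γ → m ∈ S')
    (hJ : ∀ m ∈ S', ℓ ≤ m → ∀ j ≥ J m, γ ≤ F.rank [m, j])
    {z : CoherentPoint J M S} (hz : IsWindow A ℓ z)
    {w : CoherentPoint J M S'} (hw : w ∈ F.lowerNhd γ A ℓ z.real) {R : Set (List ℕ)}
    (hR : R.Finite) (hwR : ∀ σ ∈ R, w.labels σ = true) (hRγ : ∀ σ ∈ R, F.rank σ < γ) :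
    ∃ v : CoherentPoint J M S, v ∈ basicNhd A ℓ z.real ∧ v.real = w.real ∧
      ∀ σ ∈ R, v.labels σ = true := by
  let A₂ : Set (List ℕ) := {σ | σ ∈ A ∧ 2 ≤ σ.length}
  have hlen : ∀ σ ∈ A₂ ∪ R, 2 ≤ σ.length := fun σ hσ => hσ.elim And.right fun hσR =>
    two_le_length_of_rank_lt hγ hS' (hwR σ hσR) (hRγ σ hσR)
  have hchild : ∀ σ ∈ A₂ ∪ R, ∀ k : ℕ, σ ++ [k] ∉ A₂ ∪ R := by
    rintro σ (hσ | hσ) k (hk | hk)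
    · exact hz.append_notMem hσ.1 k hk.1
    · simpa [hwR _ hk] using label_append_eq_false_of_mem_lowerNhd hw hσ.1 (hRγ _ hk)
    · have hle : F.rank (σ ++ [k]) ≤ γ := (F.rank_append_le σ k).trans (hRγ σ hσ).le
      simpa [hw.1 _ hk.1 hle] using w.isConsistent.child_eq_false (hwR σ hσ) k
    · simpa [hwR _ hk] using w.isConsistent.child_eq_false (hwR σ hσ) k
  have hpair : ∀ m j, [m, j] ∈ A₂ ∪ R → m ∈ S ∧ m < ℓ := fun m j hmj => hmj.elim
    (fun h => ⟨hz.mem_of_pair_mem h.1, hz.lt_of_pair_mem m j h.1⟩)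
    fun h => mem_and_lt_of_label_pair_eq_true hJ hz hw (hwR _ h) (hRγ _ h)
  have hfin : (A₂ ∪ R).Finite := (A.finite_toSet.subset fun σ hσ => hσ.1).union hR
  obtain ⟨v, hvreal, hv⟩ := hz.exists_extending hM (fun _ _ hm => hm) hfin hlen hchild
    (fun σ hσ h => .inl ⟨hσ, h⟩) hpair hw.2.2
  refine ⟨v, ⟨fun σ hσ => ?_, fun i hi => hvreal ▸ hw.2.2 i hi⟩, hvreal, fun σ hσ => hv σ (.inr hσ)⟩
  rcases lt_or_ge σ.length 2 with hlen | hlen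
  · rw [v.label_eq_label_of_length_lt_two z hlen, hz.label_eq_true σ hσ]
  · exact hv σ (.inl ⟨hσ, hlen⟩)

theorem exists_amalgam_mem_lowerNhd (hM : DenseRange M) (hγ : γ < α) (hγ' : γ' < γ)
    (hS' : ∀ m, F.rank [m] < γ → m ∈ S') (hJ : ∀ m ∈ S', ℓ ≤ m → ∀ j ≥ J m, γ ≤ F.rank [m, j])
    {z : CoherentPoint J M S} (hz : IsWindow A ℓ z) {w : CoherentPoint J M S'}
    (hw : w ∈ F.lowerNhd γ A ℓ z.real) (hA' : ∀ σ ∈ A', w.labels σ = true) :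
    (basicNhd A ℓ z.real ∩ F.lowerNhd γ' A' ℓ' w.real : Set (CoherentPoint J M S)).Nonempty := by
  let R₁ : Set (List ℕ) := {σ | σ ∈ A' ∧ F.rank σ ≤ γ'}
  let R₂ : Set (List ℕ) := ⋃ σ ∈ {σ | σ ∈ A' ∧ γ' < F.rank σ},
    (fun k => positiveWitness w.labels (σ ++ [k])) '' {k : ℕ | F.rank (σ ++ [k]) < γ'}
  have hR₂ : R₂.Finite := .biUnion (A'.finite_toSet.subset fun σ hσ => hσ.1) fun σ hσ =>
    (F.finite_setOf_rank_append_lt hσ.2).image _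
  have hw_true : ∀ σ ∈ R₁ ∪ R₂, w.labels σ = true := by
    rintro σ (hσ | hσ)
    · exact hA' σ hσ.1
    · obtain ⟨τ, -, k, -, rfl⟩ := mem_iUnion₂.1 hσ
      exact w.isConsistent.positiveWitness_eq_true _
  have hrank : ∀ σ ∈ R₁ ∪ R₂, F.rank σ < γ := by
    rintro σ (hσ | hσ)
    · exact hσ.2.trans_lt hγ'
    · obtain ⟨τ, -, k, hk, rfl⟩ := mem_iUnion₂.1 hσ
      exact (F.rank_positiveWitness_le _ _).trans_lt (hk.trans hγ')
  obtain ⟨v, hvA, hvreal, hv⟩ := exists_amalgam hM hγ hS' hJ hz hw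
    ((A'.finite_toSet.subset fun σ hσ => hσ.1).union hR₂) hw_true hrank
  refine ⟨v, hvA, fun σ hσ hle => hv σ (.inl ⟨hσ, hle⟩), fun σ hσ hlt k hk => ?_,
    fun i _ => congrFun hvreal i⟩
  have hmem : positiveWitness w.labels (σ ++ [k]) ∈ R₂ := mem_biUnion ⟨hσ, hlt⟩ ⟨k, hk, rfl⟩
  rw [v.isConsistent.eq_of_positiveWitness (hv _ (.inr hmem)),
    w.isConsistent.child_eq_false (hA' σ hσ)]

end LowerNhd

end LadderSystem

namespace LadderSystem

variable {α : Ordinal.{0}} (F : LadderSystem α)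

section ToW

variable {J : ℕ → ℕ} {M : ℕ → ℕ → Bool} {S : Set ℕ}

/-- The point of `𝕏_α` given by the restriction of a coherent labelling to the leaves of `T_α`. -/
def toPoint (z : CoherentPoint J M S) : F.Point := (fun σ => z.labels σ.1, z.real)

theorem label_toPoint (z : CoherentPoint J M S) {σ : List ℕ} (hσ : F.IsNode σ) :
    F.label (F.toPoint z).1 σ = z.labels σ := by
  induction hrank : F.rank σ using WellFoundedLT.induction generalizing σ with
  | ind β ih =>
    subst hrank
    by_cases hσ₀ : F.rank σ = 0
    · exact F.label_leaf (F.toPoint z).1 ⟨σ, hσ, hσ₀⟩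
    · have hfalse : F.label (F.toPoint z).1 σ = false ↔ z.labels σ = false := by
        rw [F.label_eq_false_iff _ hσ₀, z.isConsistent.eq_false_iff]
        exact exists_congr fun k => by rw [ih _ (F.rank_child_lt hσ₀ k) (hσ.child k hσ₀) rfl]
      rwa [Bool.eq_iff_iff, ← not_iff_not, Bool.not_eq_true, Bool.not_eq_true]

theorem rank_root_ne_zero (hF : ∀ m : ℕ, F.rank [m] ≠ 0) : F.rank [] ≠ 0 := fun h =>
  hF 0 (le_bot_iff.1 ((F.rank_append_le [] 0).trans_eq h))

theorem isNode_singleton (hF : ∀ m : ℕ, F.rank [m] ≠ 0) (m : ℕ) : F.IsNode [m] :=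
  .child m .root (F.rank_root_ne_zero hF)

theorem toPoint_mem_setW (hF : ∀ m : ℕ, F.rank [m] ≠ 0) (z : CoherentPoint J M S) :
    F.toPoint z ∈ F.setW M := by
  intro m hm i hi
  have hmS : m ∈ S := by
    simp only [nx, lt_iSup_iff] at hm
    obtain ⟨n, hn, hmn⟩ := hm
    rw [← z.label_singleton_eq_false_iff, ← F.label_toPoint z (F.isNode_singleton hF m)]
    exact hn m (by exact_mod_cast hmn)
  obtain ⟨k, -, hk, hkM⟩ := z.2.exists_witness m hmS
  have hkx : F.kx (F.toPoint z).1 m = k := by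
    have hnode (j : ℕ) : F.IsNode [m, j] := (F.isNode_singleton hF m).child j (hF m)
    simp only [kx, F.label_toPoint z (hnode _)]
    exact hk.csInf_eq
  rw [hkx]
  exact hkM i (Nat.lt_succ_iff.1 hi)

variable {F}

/-- The map from coherent points to `𝕎_α` that forgets the labels at sequences other than the
leaves of `T_α`. -/
def toW (hF : ∀ m : ℕ, F.rank [m] ≠ 0) (z : CoherentPoint J M S) : F.setW M :=
  ⟨F.toPoint z, F.toPoint_mem_setW hF z⟩

theorem continuous_toW (hF : ∀ m : ℕ, F.rank [m] ≠ 0) :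
    Continuous (toW hF : CoherentPoint J M S → F.setW M) :=
  .subtype_mk (.prodMk (continuous_pi fun σ => (continuous_apply σ.1).comp
    (continuous_fst.comp continuous_subtype_val)) (continuous_snd.comp continuous_subtype_val)) _

theorem exists_finset_leaf_forall_toW_mem (hF : ∀ m : ℕ, F.rank [m] ≠ 0) {U : Set (F.setW M)}
    (hU : IsOpen U) {S' : Set ℕ} {w : CoherentPoint J M S'} (hw : toW hF w ∈ U) :
    ∃ I : Finset F.Leaf, ∀ v : CoherentPoint J M S, v.real = w.real →
      (∀ σ ∈ I, v.labels σ.1 = w.labels σ.1) → toW hF v ∈ U := by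
  obtain ⟨U', hU', rfl⟩ := isOpen_induced_iff.1 hU
  obtain ⟨I, ℓ, hI⟩ := exists_finset_forall_eq_imp_mem hU' hw
  exact ⟨I, fun v hreal hlabels => hI _ hlabels fun i _ => congrFun hreal i⟩

end ToW

section Forcing

variable {F} {J : ℕ → ℕ} {M : ℕ → ℕ → Bool} {A : Finset (List ℕ)} {ℓ : ℕ}

theorem lowerNhd_inter_preimage_toW_eq_empty (hM : DenseRange M) (hF : ∀ m : ℕ, F.rank [m] ≠ 0)
    {S S' : Set ℕ} (hS' : ∀ m, F.rank [m] < 1 → m ∈ S') (hα : 1 < α)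
    {U : Set (F.setW M)} (hU : IsOpen U)
    (hJ : ∀ m ∈ S', ℓ ≤ m → ∀ j ≥ J m, 1 ≤ F.rank [m, j])
    {z : CoherentPoint J M S} (hz : IsWindow A ℓ z)
    (hmeagre : IsMeagre (basicNhd A ℓ z.real ∩ toW hF ⁻¹' U : Set (CoherentPoint J M S))) :
    (F.lowerNhd 1 A ℓ z.real ∩ toW hF ⁻¹' U : Set (CoherentPoint J M S')) = ∅ := by
  refine eq_empty_of_forall_notMem fun w hw => ?_
  obtain ⟨I, hI⟩ := exists_finset_leaf_forall_toW_mem (S := S) hF hU hw.2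
  obtain ⟨v, hvA, hvreal, hv⟩ := exists_amalgam hM hα hS' hJ hz hw.1
    (R := (fun σ : F.Leaf => positiveWitness w.labels σ.1) '' I) (I.finite_toSet.image _)
    (forall_mem_image.2 fun σ _ => w.isConsistent.positiveWitness_eq_true σ.1)
    (forall_mem_image.2 fun σ _ =>
      ((F.rank_positiveWitness_le _ σ.1).trans_eq σ.2.2).trans_lt zero_lt_one)
  have hvU : toW hF v ∈ U := hI v hvreal fun σ hσ =>
    v.isConsistent.eq_of_positiveWitness (hv _ (mem_image_of_mem _ hσ))
  exact not_isMeagre_of_isOpen ((isOpen_basicNhd _ _ _).inter (hU.preimage (continuous_toW hF)))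
    ⟨v, hvA, hvU⟩ hmeagre

theorem isMeagre_lowerNhd_inter_preimage_toW (hM : DenseRange M) (hF : ∀ m : ℕ, F.rank [m] ≠ 0)
    (hJ : F.IsTailBound J) {γ : Ordinal.{0}} (hγ : γ < α) {B : Set (F.setW M)}
    (hB : SigmaZero γ B) {S S' : Set ℕ} (hS : ∀ m, F.rank [m] < γ → m ∈ S)
    (hS' : ∀ m, F.rank [m] < γ → m ∈ S')
    (htail : ∀ m ∈ S', ℓ ≤ m → ∀ j ≥ J m, γ ≤ F.rank [m, j])
    {z : CoherentPoint J M S} (hz : IsWindow A ℓ z)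
    (hmeagre : IsMeagre (basicNhd A ℓ z.real ∩ toW hF ⁻¹' B : Set (CoherentPoint J M S))) :
    IsMeagre (F.lowerNhd γ A ℓ z.real ∩ toW hF ⁻¹' B : Set (CoherentPoint J M S')) := by
  induction hB generalizing S S' A ℓ with
  | ofOpen hU =>
    rw [lowerNhd_inter_preimage_toW_eq_empty hM hF hS' hγ hU htail hz hmeagre]
    exact .empty
  | @iUnion γ β P hβ hP ih =>
    rw [preimage_iUnion, inter_iUnion]
    refine isMeagre_iUnion fun i => by_contra fun hnonmeagre => ?_
    have hmeas : BaireMeasurableSet (toW hF ⁻¹' P i : Set (CoherentPoint J M S')) :=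
      .of_compl ((hP i).preimage (continuous_toW hF)).baireMeasurableSet
    obtain ⟨V, hVlower, hV, ⟨w, hw⟩, hVP⟩ :=
      exists_isOpen_isMeagre_diff F.isOpen_lowerNhd hmeas hnonmeagre
    obtain ⟨N, hN⟩ := eventually_atTop.1 (hJ (β i) ((Order.succ_le_of_lt (hβ i)).trans_lt hγ))
    obtain ⟨A', ℓ', hℓ', hA', hsub⟩ := exists_isWindow_basicNhd_subset hV hw N
    have hbasic' : IsMeagre
        (basicNhd A' ℓ' w.real ∩ toW hF ⁻¹' (P i)ᶜ : Set (CoherentPoint J M S')) :=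
      hVP.mono (inter_subset_inter_left _ hsub)
    have hlower : IsMeagre
        (F.lowerNhd (β i) A' ℓ' w.real ∩ toW hF ⁻¹' (P i)ᶜ : Set (CoherentPoint J M S)) :=
      ih i ((hβ i).trans hγ) (fun m hm => hS' m (hm.trans (hβ i)))
        (fun m hm => hS m (hm.trans (hβ i))) (fun m _ hm => hN m (hℓ'.trans hm)) hA' hbasic'
    have hbasic : IsMeagre (basicNhd A ℓ z.real ∩ toW hF ⁻¹' P i : Set (CoherentPoint J M S)) :=
      hmeagre.mono (inter_subset_inter_right _ (preimage_mono (subset_iUnion P i)))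
    have hinter : IsMeagre
        (basicNhd A ℓ z.real ∩ F.lowerNhd (β i) A' ℓ' w.real : Set (CoherentPoint J M S)) := by
      refine (hbasic.union hlower).mono fun v hv => ?_
      by_cases hvP : toW hF v ∈ P i
      · exact .inl ⟨hv.1, hvP⟩
      · exact .inr ⟨hv.2, hvP⟩
    exact not_isMeagre_of_isOpen ((isOpen_basicNhd A ℓ z.real).inter F.isOpen_lowerNhd)
      (exists_amalgam_mem_lowerNhd hM hγ (hβ i) hS' htail hz (hVlower hw) hA'.label_eq_true) hinter

end Forcing

end LadderSystem

section Flip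

variable {J : ℕ → ℕ} {M : ℕ → ℕ → Bool} {S : Set ℕ} {n : ℕ}

namespace CoherentPoint

theorem nonempty (hM : DenseRange M) : Nonempty (CoherentPoint J M S) := by
  obtain ⟨z, -⟩ := exists_coherentPoint_of_witnesses (J := J) (M := M) (S := S) (Q := ∅)
    (y := fun _ => false) finite_empty (by simp) (by simp) (by simp) fun m _ => by
      simpa using exists_ge_forall_le_eq_of_denseRange hM (fun _ => false) m (J m)
  exact ⟨z⟩

/-- The coherent point obtained by changing the Cantor space component at `n`, the least `m` for
which `⟨m⟩` has label `1`. -/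
def flip (z : CoherentPoint J M (Iio n)) : CoherentPoint J M (Iio n) :=
  ⟨(z.labels, Function.update z.real n (!z.real n)), z.isConsistent, z.2.label_eq_true,
    fun m hm => by
      obtain ⟨k, hkJ, hk, hkM⟩ := z.2.exists_witness m hm
      exact ⟨k, hkJ, hk, fun i hi =>
        (Function.update_of_ne (hi.trans_lt hm).ne _ _).trans (hkM i hi)⟩⟩

theorem real_flip_self (z : CoherentPoint J M (Iio n)) : z.flip.real n = !z.real n :=
  Function.update_self ..

theorem real_flip_of_ne (z : CoherentPoint J M (Iio n)) {i : ℕ} (hi : i ≠ n) :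
    z.flip.real i = z.real i :=
  Function.update_of_ne hi ..

theorem flip_involutive : Function.Involutive (flip : CoherentPoint J M (Iio n) → _) := by
  intro z
  refine Subtype.ext (Prod.ext rfl (funext fun i => ?_))
  change z.flip.flip.real i = z.real i
  rcases eq_or_ne i n with rfl | hi
  · rw [real_flip_self, real_flip_self, Bool.not_not]
  · rw [real_flip_of_ne _ hi, real_flip_of_ne _ hi]

theorem continuous_flip : Continuous (flip : CoherentPoint J M (Iio n) → _) := by
  have hreal : Continuous (real : CoherentPoint J M (Iio n) → _) :=
    continuous_snd.comp continuous_subtype_val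
  exact .subtype_mk (.prodMk (continuous_fst.comp continuous_subtype_val)
    (hreal.update n
      ((continuous_of_discreteTopology (f := not)).comp ((continuous_apply n).comp hreal)))) _

theorem isMeagre_preimage_flip {D : Set (CoherentPoint J M (Iio n))} (hD : IsMeagre D) :
    IsMeagre (flip ⁻¹' D) :=
  let e : CoherentPoint J M (Iio n) ≃ₜ CoherentPoint J M (Iio n) :=
    ⟨flip_involutive.toPerm, continuous_flip, continuous_flip⟩
  hD.preimage_of_isOpenMap continuous_flip e.isOpenMap

end CoherentPoint

end Flip

namespace LadderSystem

variable {α : Ordinal.{0}} {F : LadderSystem α} {J : ℕ → ℕ} {M : ℕ → ℕ → Bool}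

theorem graphL_adj_flip (hF : ∀ m : ℕ, F.rank [m] ≠ 0) {n : ℕ} {z : CoherentPoint J M (Iio n)}
    (hz : z.real n = false) : (F.graphL M).Adj (toW hF z) (toW hF z.flip) := by
  have hlabel (m : ℕ) : F.label (F.toPoint z).1 [m] = true ↔ n ≤ m := by
    rw [F.label_toPoint z (F.isNode_singleton hF m), ← Bool.not_eq_false,
      z.label_singleton_eq_false_iff, mem_Iio, not_lt]
  refine ⟨rfl, ?_, n, ?_, ?_, ?_⟩
  · exact (F.label_eq_false_iff _ (F.rank_root_ne_zero hF)).2 ⟨n, (hlabel n).2 le_rfl⟩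
  · exact (Set.ext hlabel : {m | F.label (F.toPoint z).1 [m] = true} = Ici n) ▸ isLeast_Ici
  · ext i
    change i ∈ symmDiff {i | z.real i = true} {i | z.flip.real i = true} ↔ i = n
    rcases eq_or_ne i n with rfl | hi
    · simp [mem_symmDiff, z.real_flip_self, hz]
    · simp [mem_symmDiff, z.real_flip_of_ne hi, hi]
  · exact Bool.eq_false_iff.1 hz

theorem preimage_flip_lowerNhd {γ : Ordinal.{0}} {A : Finset (List ℕ)} {ℓ : ℕ} {y : ℕ → Bool} :
    (CoherentPoint.flip ⁻¹' F.lowerNhd γ A ℓ y : Set (CoherentPoint J M (Iio ℓ))) =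
      F.lowerNhd γ A ℓ y :=
  Set.ext fun w => and_congr_right fun _ => and_congr_right fun _ =>
    forall₂_congr fun i hi => by rw [w.real_flip_of_ne hi.ne]

theorem exists_graphL_adj_of_isMeagre_diff (hM : DenseRange M) (hF : ∀ m : ℕ, F.rank [m] ≠ 0)
    (hJ : F.IsTailBound J) {γ : Ordinal.{0}} (hγ : γ < α) {P : Set (F.setW M)}
    (hP : SigmaZero γ Pᶜ) {V : Set (CoherentPoint J M univ)} (hV : IsOpen V) (hne : V.Nonempty)
    (hVP : IsMeagre (V \ toW hF ⁻¹' P)) : ∃ a ∈ P, ∃ b ∈ P, (F.graphL M).Adj a b := by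
  obtain ⟨z, hz⟩ := hne
  obtain ⟨N, hN⟩ := eventually_atTop.1 (F.eventually_le_rank_append (σ := []) hγ)
  obtain ⟨A, ℓ, hNℓ, hA, hsub⟩ := exists_isWindow_basicNhd_subset hV hz N
  have hlt (m : ℕ) (hm : F.rank [m] < γ) : m < ℓ := by
    by_contra! hℓm
    exact (hN m (hNℓ.trans hℓm)).not_gt hm
  have hbasic : IsMeagre
      (basicNhd A ℓ z.real ∩ toW hF ⁻¹' Pᶜ : Set (CoherentPoint J M univ)) :=
    hVP.mono (inter_subset_inter_left _ hsub)
  have hlower : IsMeagre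
      (F.lowerNhd γ A ℓ z.real \ toW hF ⁻¹' P : Set (CoherentPoint J M (Iio ℓ))) :=
    isMeagre_lowerNhd_inter_preimage_toW hM hF hJ hγ hP (fun m _ => mem_univ m) hlt
      (fun m hm hℓm => absurd hm hℓm.not_gt) hA hbasic
  have hflip : IsMeagre (F.lowerNhd γ A ℓ z.real \ CoherentPoint.flip ⁻¹' (toW hF ⁻¹' P) :
      Set (CoherentPoint J M (Iio ℓ))) := by
    rw [← preimage_flip_lowerNhd]
    exact CoherentPoint.isMeagre_preimage_flip hlower
  have hne : (F.lowerNhd γ A ℓ z.real : Set (CoherentPoint J M (Iio ℓ))).Nonempty := by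
    have hwitness := exists_mem_lowerNhd hM hγ (fun m hm => ⟨mem_univ m, hlt m hm⟩) hA
    rwa [univ_inter] at hwitness
  obtain ⟨w, ⟨-, hwP⟩, hwP'⟩ :=
    exists_mem_inter_of_isMeagre_diff F.isOpen_lowerNhd hne hlower hflip
  cases hw : w.real ℓ with
  | false => exact ⟨_, hwP, _, hwP', graphL_adj_flip hF hw⟩
  | true =>
    have hadj := graphL_adj_flip hF (z := w.flip) (by rw [w.real_flip_self, hw, Bool.not_true])
    rw [CoherentPoint.flip_involutive w] at hadj
    exact ⟨_, hwP', _, hwP, hadj⟩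

end LadderSystem

theorem mainTheorem5_general {α : Ordinal.{0}} (F : LadderSystem α)
    (hF : ∀ m : ℕ, F.rank [m] ≠ 0) {M : ℕ → ℕ → Bool} (hM : DenseRange M) :
    ¬ HasCountableSigmaColouring α (F.graphL M) := by
  rintro ⟨c, hc, hcSigma⟩
  have hα : α ≠ 1 := by
    rintro rfl
    exact hF 0 (Order.lt_one_iff.1 (F.rank_child_lt (σ := []) (F.rank_root_ne_zero hF) 0))
  obtain ⟨J, hJ⟩ := F.exists_isTailBound
  have : Nonempty (CoherentPoint J M univ) := CoherentPoint.nonempty hM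
  obtain ⟨γ, hγ, n, P, hPn, hP, V, hV, hne, hVP⟩ := exists_comeagre_piece_of_sigmaZero_fibers
    (LadderSystem.continuous_toW (J := J) (S := univ) hF) hα hcSigma
  obtain ⟨a, ha, b, hb, hab⟩ :=
    LadderSystem.exists_graphL_adj_of_isMeagre_diff hM hF hJ hγ hP hV hne hVP
  exact hc a b hab ((hPn ha).trans (hPn hb).symm)

theorem mainTheorem5 (α : Ordinal.{0}) (hα : 3 ≤ α) (hα' : α < ω₁)
    (F : LadderSystem α)
    (hF : ∀ σ : List ℕ, F.IsNode σ → σ.length ≤ 2 → F.rank σ ≠ 0)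
    (M : ℕ → ℕ → Bool) (hM : DenseRange M) :
    ¬ HasCountableSigmaColouring α (F.graphL M) :=
  mainTheorem5_general F
    (fun m => hF [m] (.child m .root (hF [] .root (by simp))) (by simp)) hM
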